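/- A cyclotomic generating function (CGF) is a nonzero polynomial $f(q)=\sum_k c_k q^k$ with nonnegative integer coefficients all of whose complex roots are either zero or roots of unity. A real-valued random variable $\mathcal X$ corresponds to $f$ if $\mathbb P(\mathcal X=k)=c_k/f(1)$ for all integers $k\ge 0$. For $\mathcal X$ with mean $\mu$ and variance $\sigma^2$ write $\mathcal X^*=(\mathcal X-\mu)/\sigma$ for the standardized random variable, with the convention $\mathcal X^*=0$ if $\sigma=0$. Theorem. Let $\mathcal X_1,\mathcal X_2,\ldots$ be a sequence of random variables (possibly defined on different probability spaces) corresponding to cyclotomic generating functions $f_1, f_2,\ldots$. Then the sequence $\mathcal X_1^*,\mathcal X_2^*,\ldots$ converges in distribution to some real-valued random variable if and only if, for every integer $d\ge 1$, the limit $$\mu_d:=\lim_{N\to\infty}\mathbb E\big[(\mathcal X_N^*)^d\big]$$ exists and is finite. In this case, for every real-valued random variable $\mathcal X$ to which $\mathcal X_N^*$ converges in distribution: 1. for every $d\ge 1$ the moment $\mathbb E[\mathcal X^d]$ exists and equals $\mu_d$; 2. $\mathcal X$ is determined by its moments, that is, all its moments are finite and every probability measure on $\mathbb R$ with the same moments is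 the law of $\mathcal X$; 3. the moment generating function of $\mathcal X$ is entire: $\mathbb E[e^{t\mathcal X}]<\infty$ for all $t\in\mathbb R$, and $z\mapsto\mathbb E[e^{z\mathcal X}]$ is holomorphic on $\mathbb C$. -/

import Mathlib

open MeasureTheory ProbabilityTheory Filter Polynomial
open scoped Topology

/-- A cyclotomic generating function: a nonzero polynomial with nonnegative integer coefficients
all of whose complex roots are zero or roots of unity. -/
def IsCGF (f : ℕ[X]) : Prop :=
  f ≠ 0 ∧ ∀ z : ℂ, (f.map (Nat.castRingHom ℂ)).IsRoot z → z = 0 ∨ ∃ n : ℕ, 0 < n ∧ z ^ n = 1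

/-- `X` is a (real-valued) random variable corresponding to the polynomial `f = ∑ cₖ qᵏ`:
`P(X = k) = cₖ / f(1)` for every `k`, i.e. its probability generating function is `f(q)/f(1)`. -/
structure HasPGF {Ω : Type*} [MeasurableSpace Ω] (f : ℕ[X]) (X : Ω → ℝ) (P : Measure Ω) : Prop where
  aemeasurable : AEMeasurable X P
  prob : ∀ k : ℕ, P.real (X ⁻¹' {(k : ℝ)}) = (f.coeff k : ℝ) / (f.eval 1 : ℕ)

/-- The standardized random variable `(X - μ) / σ`. If `σ = 0`, this is the zero random
variable, by the convention `x / 0 = 0`. -/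
noncomputable def standardize {Ω : Type*} [MeasurableSpace Ω] (X : Ω → ℝ) (P : Measure Ω) : Ω → ℝ :=
  fun ω => (X ω - ∫ ω', X ω' ∂P) / √(variance X P)

/-- The sequence `Y` of real random variables converges in distribution to some real random
variable; without loss of generality the latter is the identity on `(ℝ, ν)`. -/
def ConvergesInDistribution {Ω : ℕ → Type*} [∀ N, MeasurableSpace (Ω N)]
    (Y : (N : ℕ) → Ω N → ℝ) (P : (N : ℕ) → Measure (Ω N)) [∀ N, IsProbabilityMeasure (P N)] :
    Prop :=
  ∃ ν : ProbabilityMeasure ℝ,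
    TendstoInDistribution Y atTop (id : ℝ → ℝ) P (ν : Measure ℝ)

/-- `X` has finite moments of all orders, and every probability measure on `ℝ` with the same
(finite) moments as `X` is the law of `X`. -/
def DeterminedByMoments {Ω : Type*} [MeasurableSpace Ω] (X : Ω → ℝ) (P : Measure Ω) : Prop :=
  (∀ d : ℕ, Integrable (fun ω => X ω ^ d) P) ∧
  ∀ ν : Measure ℝ, IsProbabilityMeasure ν →
    (∀ d : ℕ, Integrable (fun x : ℝ => x ^ d) ν) →
    (∀ d : ℕ, ∫ x, x ^ d ∂ν = moment X d P) →
    ν = P.map X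

/-- The moment generating function of `X` is entire: `E[exp(tX)]` is finite for all real `t`
(equivalently `exp(zX)` is integrable for all complex `z`), and `z ↦ E[exp(zX)]` is holomorphic
on all of `ℂ`. -/
def HasEntireMGF {Ω : Type*} [MeasurableSpace Ω] (X : Ω → ℝ) (P : Measure Ω) : Prop :=
  (∀ t : ℝ, Integrable (fun ω => Real.exp (t * X ω)) P) ∧ Differentiable ℂ (complexMGF X P)

/-! Everything rests on one bound, uniform over all cyclotomic generating functions, for the moment
generating function (mgf) of the standardized variable. The mgf of `X` is f(eᵗ)/f(1). Factoring f
over its roots, all of them zero or on the unit circle and none equal to 1, its square becomes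
e^{Lt} ∏ (1 + a (cosh t - 1)) with a = 1/(1 - Re z) ≥ 1/2. Comparing derivatives at 0 gives L = 2μ
and ∑ a = 2σ². Hence σ² is 0 or at least 1/4, and 1 + x ≤ eˣ bounds the centred mgf by exp(σ² (cosh
t - 1)). Rescaling by σ leaves a bound depending on t alone (`HasPGF.mgfBoundedBy_map_standardize`).

Such a bound gives tightness, lets moments pass to weak limits, and is inherited by the limit, whose
mgf is therefore entire and which is determined by its moments. Conversely, if the moments converge,
all subsequential limits share them and so coincide
(`MGFBoundedBy.exists_tendsto_of_tendsto_moment`). -/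

/-! ### Probability measures on `ℝ` whose moment generating function is everywhere finite -/

/-- The moment generating function of `ν` is finite everywhere and bounded by `C`. -/
def MGFBoundedBy (C : ℝ → ℝ) (ν : Measure ℝ) : Prop :=
  ∀ t : ℝ, Integrable (fun x ↦ Real.exp (t * x)) ν ∧ ∫ x, Real.exp (t * x) ∂ν ≤ C t

lemma interior_integrableExpSet_eq_univ {Ω : Type*} [MeasurableSpace Ω] {X : Ω → ℝ}
    {P : Measure Ω} (h : ∀ t : ℝ, Integrable (fun ω ↦ Real.exp (t * X ω)) P) :
    interior (integrableExpSet X P) = Set.univ := by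
  have : integrableExpSet X P = Set.univ := Set.eq_univ_of_forall h
  simp [this]

lemma integrable_pow_of_forall_integrable_exp {Ω : Type*} [MeasurableSpace Ω] {X : Ω → ℝ}
    {P : Measure Ω} (h : ∀ t : ℝ, Integrable (fun ω ↦ Real.exp (t * X ω)) P) (d : ℕ) :
    Integrable (fun ω ↦ X ω ^ d) P :=
  integrable_pow_of_integrable_exp_mul one_ne_zero (h 1) (h (-1)) d

lemma differentiable_complexMGF {Ω : Type*} [MeasurableSpace Ω] {X : Ω → ℝ}
    {P : Measure Ω} (h : ∀ t : ℝ, Integrable (fun ω ↦ Real.exp (t * X ω)) P) :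
    Differentiable ℂ (complexMGF X P) := fun z ↦
  (analyticAt_complexMGF (by simp [interior_integrableExpSet_eq_univ h])).differentiableAt

lemma iteratedDeriv_complexMGF_zero {ν : Measure ℝ}
    (h : ∀ t : ℝ, Integrable (fun x ↦ Real.exp (t * x)) ν) (n : ℕ) :
    iteratedDeriv n (complexMGF id ν) 0 = ((∫ x, x ^ n ∂ν : ℝ) : ℂ) := by
  rw [iteratedDeriv_complexMGF
    (by rw [interior_integrableExpSet_eq_univ (X := id) h]; trivial), ← integral_complex_ofReal]
  simp

/-- An everywhere finite moment generating function is inherited by every measure with the same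
moments, by expanding the hyperbolic cosine. -/
lemma integrable_exp_of_moments_eq {ν ν' : Measure ℝ} [IsProbabilityMeasure ν]
    [IsProbabilityMeasure ν']
    (h : ∀ t : ℝ, Integrable (fun x ↦ Real.exp (t * x)) ν)
    (hint : ∀ d : ℕ, Integrable (fun x : ℝ ↦ x ^ d) ν')
    (hmom : ∀ d : ℕ, ∫ x, x ^ d ∂ν' = ∫ x, x ^ d ∂ν) (t : ℝ) :
    Integrable (fun x ↦ Real.exp (t * x)) ν' := by
  -- Only even powers occur, so all terms are nonnegative and Tonelli applies before integrability
  -- is known.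
  have expand (ρ : Measure ℝ) (hρ : ∀ d : ℕ, Integrable (fun x : ℝ ↦ x ^ d) ρ) :
      ∫⁻ x, ENNReal.ofReal (Real.cosh (t * x)) ∂ρ =
        ∑' n : ℕ, ENNReal.ofReal (t ^ (2 * n) / (2 * n).factorial * ∫ x, x ^ (2 * n) ∂ρ) := by
    have hnn (n : ℕ) (y : ℝ) : 0 ≤ y ^ (2 * n) / (2 * n).factorial :=
      div_nonneg (Even.pow_nonneg (even_two_mul n) y) (by positivity)
    have : ∀ x : ℝ, ENNReal.ofReal (Real.cosh (t * x)) =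
        ∑' n : ℕ, ENNReal.ofReal ((t * x) ^ (2 * n) / (2 * n).factorial) := fun x ↦ by
      rw [← (Real.hasSum_cosh (t * x)).tsum_eq, ENNReal.ofReal_tsum_of_nonneg (fun n ↦ hnn n _)
        (Real.hasSum_cosh (t * x)).summable]
    simp_rw [this]
    rw [lintegral_tsum (fun n ↦ by fun_prop)]
    refine tsum_congr fun n ↦ ?_
    have e : ∀ x : ℝ, (t * x) ^ (2 * n) / (2 * n).factorial =
        t ^ (2 * n) / (2 * n).factorial * x ^ (2 * n) := fun x ↦ by ring
    rw [← ofReal_integral_eq_lintegral_ofReal]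
    · simp_rw [e, integral_const_mul]
    · simp_rw [e]
      exact (hρ _).const_mul _
    · exact Eventually.of_forall fun x ↦ hnn n _
  have hcosh : Integrable (fun x ↦ Real.cosh (t * x)) ν := by
    simp_rw [Real.cosh_eq, ← neg_mul]
    exact ((h t).add (h (-t))).div_const 2
  have hcosh' : Integrable (fun x ↦ Real.cosh (t * x)) ν' := by
    refine ⟨by fun_prop, ?_⟩
    rw [hasFiniteIntegral_iff_ofReal (Eventually.of_forall fun x ↦ (Real.cosh_pos _).le),
      expand ν' hint]
    simp_rw [hmom]
    rw [← expand ν (integrable_pow_of_forall_integrable_exp h),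
      ← hasFiniteIntegral_iff_ofReal (Eventually.of_forall fun x ↦ (Real.cosh_pos _).le)]
    exact hcosh.2
  refine (hcosh'.const_mul 2).mono' (by fun_prop) (Eventually.of_forall fun x ↦ ?_)
  rw [Real.norm_eq_abs, Real.abs_exp, Real.cosh_eq]
  have := Real.exp_pos (-(t * x))
  linarith

/-- A probability measure with everywhere finite moment generating function is determined by its
moments. -/
lemma eq_of_moments_eq {ν ν' : Measure ℝ} [IsProbabilityMeasure ν] [IsProbabilityMeasure ν']
    (h : ∀ t : ℝ, Integrable (fun x ↦ Real.exp (t * x)) ν)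
    (hint : ∀ d : ℕ, Integrable (fun x : ℝ ↦ x ^ d) ν')
    (hmom : ∀ d : ℕ, ∫ x, x ^ d ∂ν' = ∫ x, x ^ d ∂ν) : ν' = ν := by
  have h' := integrable_exp_of_moments_eq h hint hmom
  refine Measure.ext_of_complexMGF_id_eq (funext fun z ↦ ?_)
  -- Both transforms are entire, and their Taylor coefficients at 0 are given by the moments.
  rw [← Complex.taylorSeries_eq_of_entire (differentiable_complexMGF (X := id) h') 0 z,
    ← Complex.taylorSeries_eq_of_entire (differentiable_complexMGF (X := id) h) 0 z]
  simp_rw [iteratedDeriv_complexMGF_zero h, iteratedDeriv_complexMGF_zero h', hmom]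

/-! ### Weak convergence under a uniform bound on the mgf -/

namespace MGFBoundedBy

variable {C : ℝ → ℝ}

lemma nonneg {ν : Measure ℝ} (h : MGFBoundedBy C ν) (t : ℝ) : 0 ≤ C t :=
  (integral_nonneg fun _ ↦ (Real.exp_pos _).le).trans (h t).2

/-- Bounds on moment generating functions pass to weak limits. -/
lemma of_tendsto {ν : ℕ → ProbabilityMeasure ℝ} {ρ : ProbabilityMeasure ℝ}
    (hC : ∀ n, MGFBoundedBy C (ν n)) (hν : Tendsto ν atTop (𝓝 ρ)) :
    MGFBoundedBy C (ρ : Measure ℝ) := by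
  intro t
  -- Portmanteau for open sets yields a Fatou inequality for the unbounded nonnegative integrand.
  have hle : ∫⁻ x, ENNReal.ofReal (Real.exp (t * x)) ∂(ρ : Measure ℝ) ≤ ENNReal.ofReal (C t) := by
    refine (lintegral_le_liminf_lintegral_of_forall_isOpen_measure_le_liminf_measure
      (μs := fun n ↦ (ν n : Measure ℝ)) (by fun_prop)
      (fun x ↦ (Real.exp_pos _).le)
      fun G hG ↦ ProbabilityMeasure.le_liminf_measure_open_of_tendsto hν hG).trans ?_
    refine (liminf_le_liminf (v := fun _ ↦ ENNReal.ofReal (C t))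
      (Eventually.of_forall fun n ↦ ?_)).trans (by simp)
    rw [← ofReal_integral_eq_lintegral_ofReal (hC n t).1
      (Eventually.of_forall fun x ↦ (Real.exp_pos _).le)]
    exact ENNReal.ofReal_le_ofReal (hC n t).2
  have hint : Integrable (fun x ↦ Real.exp (t * x)) (ρ : Measure ℝ) := by
    refine ⟨by fun_prop, ?_⟩
    rw [hasFiniteIntegral_iff_ofReal (Eventually.of_forall fun x ↦ (Real.exp_pos _).le)]
    exact hle.trans_lt ENNReal.ofReal_lt_top
  refine ⟨hint, ?_⟩
  rwa [← ofReal_integral_eq_lintegral_ofReal hint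
    (Eventually.of_forall fun x ↦ (Real.exp_pos _).le),
    ENNReal.ofReal_le_ofReal_iff ((hC 0).nonneg t)] at hle

/-- Chernoff's bound with parameters 1 and -1 controls the two tails uniformly. -/
lemma isTightMeasureSet {S : Set (Measure ℝ)} (hS : ∀ ν ∈ S, IsProbabilityMeasure ν)
    (hC : ∀ ν ∈ S, MGFBoundedBy C ν) : IsTightMeasureSet S := by
  rw [isTightMeasureSet_iff_exists_isCompact_measure_compl_le]
  intro ε hε
  have hlim : Tendsto (fun r : ℝ ↦ ENNReal.ofReal (Real.exp (-r) * (C 1 + C (-1)))) atTop (𝓝 0) := by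
    have : Tendsto (fun r : ℝ ↦ Real.exp (-r) * (C 1 + C (-1))) atTop (𝓝 0) := by
      simpa using Real.tendsto_exp_neg_atTop_nhds_zero.mul_const (C 1 + C (-1))
    simpa using ENNReal.tendsto_ofReal this
  obtain ⟨r, hr⟩ := ((tendsto_order.1 hlim).2 ε hε).exists
  refine ⟨Set.Icc (-r) r, isCompact_Icc, fun ν hν ↦ le_trans ?_ hr.le⟩
  have := hS ν hν
  have h1 := measure_ge_le_exp_mul_mgf (X := id) (μ := ν) r zero_le_one (hC ν hν 1).1
  have h2 := measure_le_le_exp_mul_mgf (X := id) (μ := ν) (-r) (by norm_num : (-1 : ℝ) ≤ 0)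
    (hC ν hν (-1)).1
  have hsub : (Set.Icc (-r) r)ᶜ ⊆ {x : ℝ | r ≤ id x} ∪ {x : ℝ | id x ≤ -r} := by
    intro x hx
    simp only [Set.mem_compl_iff, Set.mem_Icc, not_and_or, not_le] at hx
    exact hx.symm.imp le_of_lt le_of_lt
  rw [← ENNReal.ofReal_toReal (measure_ne_top ν (Set.Icc (-r) r)ᶜ)]
  refine ENNReal.ofReal_le_ofReal ?_
  calc ν.real (Set.Icc (-r) r)ᶜ ≤ ν.real {x : ℝ | r ≤ id x} + ν.real {x : ℝ | id x ≤ -r} :=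
        (measureReal_mono hsub).trans (measureReal_union_le _ _)
    _ ≤ Real.exp (-r) * C 1 + Real.exp (-r) * C (-1) := by
        refine add_le_add (h1.trans ?_) (h2.trans ?_)
        · rw [neg_one_mul]
          exact mul_le_mul_of_nonneg_left (hC ν hν 1).2 (Real.exp_pos _).le
        · rw [neg_neg, one_mul]
          exact mul_le_mul_of_nonneg_left (hC ν hν (-1)).2 (Real.exp_pos _).le
    _ = _ := by ring

/-- The error made in a moment when clamping to `[-K, K]`. -/
lemma abs_integral_pow_sub_clamp_le {ν : Measure ℝ} [IsProbabilityMeasure ν]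
    (h : MGFBoundedBy C ν) (d : ℕ) {K : ℝ} (hK : 0 < K) :
    |∫ x, x ^ d ∂ν - ∫ x, (max (-K) (min K x)) ^ d ∂ν| ≤
      2 * (d + 1).factorial * (C 1 + C (-1)) / K := by
  have hclamp (x : ℝ) : |max (-K) (min K x)| ≤ K :=
    abs_le.2 ⟨le_max_left _ _, max_le (by linarith) (min_le_left _ _)⟩
  have hclamp' (x : ℝ) : |max (-K) (min K x)| ≤ |x| := by
    rcases le_total K x with hx | hx
    · rw [min_eq_left hx, max_eq_right (by linarith), abs_of_pos hK]
      exact hx.trans (le_abs_self x)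
    · rw [min_eq_right hx]
      rcases le_total (-K) x with hx' | hx'
      · rw [max_eq_right hx']
      · rw [max_eq_left hx', abs_neg, abs_of_pos hK]
        exact (le_neg.2 hx').trans (neg_le_abs x)
  have hint : Integrable (fun x ↦ x ^ d) ν :=
    integrable_pow_of_forall_integrable_exp (X := id) (fun t ↦ (h t).1) d
  have hintc : Integrable (fun x ↦ (max (-K) (min K x)) ^ d) ν := by
    refine Integrable.of_bound (by fun_prop) (K ^ d) (Eventually.of_forall fun x ↦ ?_)
    rw [norm_pow, Real.norm_eq_abs]
    exact pow_le_pow_left₀ (abs_nonneg _) (hclamp x) d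
  have hbound (x : ℝ) : |x ^ d - (max (-K) (min K x)) ^ d| ≤
      2 * (d + 1).factorial / K * (Real.exp (1 * x) + Real.exp (-1 * x)) := by
    rcases le_or_gt |x| K with hx | hx
    · rw [abs_le] at hx
      rw [min_eq_right hx.2, max_eq_right hx.1, sub_self, abs_zero]
      positivity
    · have h1 : |x ^ d - (max (-K) (min K x)) ^ d| ≤ 2 * |x| ^ d := by
        refine (abs_sub _ _).trans ?_
        rw [abs_pow, abs_pow, two_mul]
        exact add_le_add le_rfl (pow_le_pow_left₀ (abs_nonneg _) (hclamp' x) d)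
      -- One power more than needed: where |x| > K, the surplus factor |x| supplies the 1/K.
      have h2 : |x| ^ (d + 1) ≤ (d + 1).factorial * Real.exp |x| := by
        have := Real.pow_div_factorial_le_exp |x| (abs_nonneg x) (d + 1)
        rwa [div_le_iff₀ (by positivity), mul_comm] at this
      have h3 : Real.exp |x| ≤ Real.exp (1 * x) + Real.exp (-1 * x) := by
        rcases abs_cases x with ⟨hx, -⟩ | ⟨hx, -⟩ <;> rw [hx] <;> simp [(Real.exp_pos _).le]
      have h4 : K * |x| ^ d ≤ |x| ^ (d + 1) := by
        rw [pow_succ, mul_comm]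
        gcongr
      rw [div_mul_eq_mul_div, le_div_iff₀ hK]
      calc _ ≤ 2 * |x| ^ d * K := by gcongr
        _ = 2 * (K * |x| ^ d) := by ring
        _ ≤ 2 * ((d + 1).factorial * (Real.exp (1 * x) + Real.exp (-1 * x))) := by
          refine mul_le_mul_of_nonneg_left (h4.trans (h2.trans ?_)) zero_le_two
          exact mul_le_mul_of_nonneg_left h3 (by positivity)
        _ = _ := by ring
  rw [← integral_sub hint hintc]
  refine abs_integral_le_integral_abs.trans ?_
  refine (integral_mono (hint.sub hintc).abs (((h 1).1.add (h (-1)).1).const_mul _)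
    hbound).trans ?_
  have e : ∫ x, 2 * (d + 1).factorial / K * (Real.exp (1 * x) + Real.exp (-1 * x)) ∂ν =
      2 * (d + 1).factorial / K * (∫ x, Real.exp (1 * x) ∂ν + ∫ x, Real.exp (-1 * x) ∂ν) := by
    rw [integral_const_mul, integral_add (h 1).1 (h (-1)).1]
  refine e.le.trans ?_
  rw [mul_div_right_comm (2 * ((d + 1).factorial : ℝ))]
  exact mul_le_mul_of_nonneg_left (add_le_add (h 1).2 (h (-1)).2) (by positivity)

/-- Under a uniform bound on moment generating functions, weak convergence implies convergence of
moments. -/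
lemma tendsto_moment {ν : ℕ → ProbabilityMeasure ℝ} {ρ : ProbabilityMeasure ℝ}
    (hC : ∀ n, MGFBoundedBy C (ν n)) (hν : Tendsto ν atTop (𝓝 ρ)) (d : ℕ) :
    Tendsto (fun n ↦ ∫ x, x ^ d ∂(ν n : Measure ℝ)) atTop (𝓝 (∫ x, x ^ d ∂(ρ : Measure ℝ))) := by
  have hρ := of_tendsto hC hν
  rw [Metric.tendsto_atTop]
  intro ε hε
  have hlim : Tendsto (fun K : ℝ ↦ 2 * (d + 1).factorial * (C 1 + C (-1)) / K) atTop (𝓝 0) :=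
    tendsto_const_nhds.div_atTop tendsto_id
  obtain ⟨K, hKε, hK⟩ := (((tendsto_order.1 hlim).2 (ε / 3) (by positivity)).and
    (eventually_gt_atTop 0)).exists
  let g : BoundedContinuousFunction ℝ ℝ := BoundedContinuousFunction.ofNormedAddCommGroup
    (fun x ↦ (max (-K) (min K x)) ^ d) (by fun_prop) (K ^ d) fun x ↦ by
      rw [norm_pow, Real.norm_eq_abs]
      exact pow_le_pow_left₀ (abs_nonneg _)
        (abs_le.2 ⟨le_max_left _ _, max_le (by linarith) (min_le_left _ _)⟩) d
  have hg := ProbabilityMeasure.tendsto_iff_forall_integral_tendsto.1 hν g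
  obtain ⟨N, hN⟩ := Metric.tendsto_atTop.1 hg (ε / 3) (by positivity)
  refine ⟨N, fun n hn ↦ ?_⟩
  have h1 := (hC n).abs_integral_pow_sub_clamp_le d hK
  have h2 := hρ.abs_integral_pow_sub_clamp_le d hK
  have h3 : |∫ x, (max (-K) (min K x)) ^ d ∂(ν n : Measure ℝ) -
      ∫ x, (max (-K) (min K x)) ^ d ∂(ρ : Measure ℝ)| < ε / 3 := hN n hn
  rw [Real.dist_eq]
  rw [abs_le] at h1 h2
  rw [abs_lt] at h3 ⊢
  constructor <;> linarith [h1.1, h1.2, h2.1, h2.2, h3.1, h3.2]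

/-- Under a uniform bound on moment generating functions, convergence of moments implies weak
convergence. -/
lemma exists_tendsto_of_tendsto_moment {ν : ℕ → ProbabilityMeasure ℝ}
    (hC : ∀ n, MGFBoundedBy C (ν n)) {m : ℕ → ℝ}
    (hm : ∀ d, Tendsto (fun n ↦ ∫ x, x ^ d ∂(ν n : Measure ℝ)) atTop (𝓝 (m d))) :
    ∃ ρ : ProbabilityMeasure ℝ, Tendsto ν atTop (𝓝 ρ) := by
  -- Prokhorov's theorem.
  have hcpt : IsCompact (closure (Set.range ν)) := by
    refine isCompact_closure_of_isTightMeasureSet (MGFBoundedBy.isTightMeasureSet (C := C) ?_ ?_)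
    · rintro _ ⟨_, ⟨n, rfl⟩, rfl⟩
      infer_instance
    · rintro _ ⟨_, ⟨n, rfl⟩, rfl⟩
      exact hC n
  have hsub (φ : ℕ → ℕ) (hφ : Tendsto φ atTop atTop) : ∃ ψ : ℕ → ℕ, ∃ ρ : ProbabilityMeasure ℝ,
      Tendsto (fun n ↦ ν (φ (ψ n))) atTop (𝓝 ρ) ∧ MGFBoundedBy C (ρ : Measure ℝ) ∧
      ∀ d, ∫ x, x ^ d ∂(ρ : Measure ℝ) = m d := by
    obtain ⟨ρ, -, ψ, hψ, hρ⟩ := hcpt.tendsto_subseq (x := fun n ↦ ν (φ n))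
      fun n ↦ subset_closure ⟨_, rfl⟩
    exact ⟨ψ, ρ, hρ, of_tendsto (fun n ↦ hC _) hρ, fun d ↦
      tendsto_nhds_unique (tendsto_moment (fun n ↦ hC _) hρ d)
        ((hm d).comp (hφ.comp hψ.tendsto_atTop))⟩
  obtain ⟨-, ρ, -, hρ, hρm⟩ := hsub id tendsto_id
  refine ⟨ρ, tendsto_of_subseq_tendsto fun φ hφ ↦ ?_⟩
  obtain ⟨ψ, ρ', hlim, hρ', hρm'⟩ := hsub φ hφ
  -- Any two subsequential limits have the moments `m`, which determine them.
  have heq : (ρ' : Measure ℝ) = ρ := eq_of_moments_eq (fun t ↦ (hρ t).1)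
    (integrable_pow_of_forall_integrable_exp (X := id) fun t ↦ (hρ' t).1)
    fun d ↦ (hρm' d).trans (hρm d).symm
  exact ⟨ψ, (Subtype.ext heq : ρ' = ρ) ▸ hlim⟩

end MGFBoundedBy


/-! ### Generating functions with roots on the unit circle -/

/-- The real polynomial function underlying a polynomial with natural coefficients. -/
noncomputable def realEval (f : ℕ[X]) (x : ℝ) : ℝ := f.eval₂ (Nat.castRingHom ℝ) x

lemma realEval_eq_sum (f : ℕ[X]) (x : ℝ) :
    realEval f x = ∑ k ∈ Finset.range (f.natDegree + 1), (f.coeff k : ℝ) * x ^ k := by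
  simp [realEval, eval₂_eq_sum_range]

lemma realEval_one (f : ℕ[X]) : realEval f 1 = (f.eval 1 : ℕ) := by
  rw [realEval, eval₂_at_one]
  rfl

lemma ofReal_realEval (f : ℕ[X]) (x : ℝ) :
    (realEval f x : ℂ) = (f.map (Nat.castRingHom ℂ)).eval (x : ℂ) := by
  rw [realEval, eval_map, ← Complex.ofRealHom_eq_coe, hom_eval₂]
  congr 1

lemma IsCGF.realEval_one_pos {f : ℕ[X]} (hf : IsCGF f) : 0 < realEval f 1 := by
  rw [realEval_one, Nat.cast_pos, Nat.pos_iff_ne_zero]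
  intro h
  rw [eval_eq_sum_range] at h
  simp only [one_pow, mul_one, Finset.sum_eq_zero_iff, Finset.mem_range, Nat.lt_succ_iff] at h
  exact hf.1 (leadingCoeff_eq_zero.1 (h _ le_rfl))

lemma sq_norm_exp_sub_of_norm_eq_one {z : ℂ} (hz : ‖z‖ = 1) (t : ℝ) :
    ‖((Real.exp t : ℝ) : ℂ) - z‖ ^ 2 = 2 * Real.exp t * (Real.cosh t - z.re) := by
  have h : z.re * z.re + z.im * z.im = 1 := by
    rw [← Complex.normSq_apply, Complex.normSq_eq_norm_sq, hz, one_pow]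
  rw [← Complex.normSq_eq_norm_sq, Complex.normSq_apply, Real.cosh_eq, Real.exp_neg]
  have := (Real.exp_pos t).ne'
  simp only [Complex.sub_re, Complex.ofReal_re, Complex.sub_im, Complex.ofReal_im]
  field_simp
  linear_combination h

/-- The squared norm of `∏ (eᵗ - z)` over points `z` which are zero or on the unit circle. -/
lemma exists_sq_norm_prod_exp_sub_eq (R : Multiset ℂ)
    (hR : ∀ z ∈ R, z = 0 ∨ ‖z‖ = 1 ∧ z ≠ 1) :
    ∃ (L : ℝ) (s : Multiset ℝ), (∀ a ∈ s, 1 / 2 ≤ a) ∧ ∀ t : ℝ,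
      ‖(R.map fun z ↦ ((Real.exp t : ℝ) : ℂ) - z).prod‖ ^ 2 =
        ‖(R.map fun z ↦ 1 - z).prod‖ ^ 2 *
          (Real.exp (L * t) * (s.map fun a ↦ 1 + a * (Real.cosh t - 1)).prod) := by
  induction R using Multiset.induction_on with
  | empty => exact ⟨0, 0, by simp, by simp⟩
  | cons z R ih =>
    obtain ⟨L, s, hs, h⟩ := ih fun w hw ↦ hR w (Multiset.mem_cons_of_mem hw)
    rcases hR z (Multiset.mem_cons_self z R) with rfl | ⟨hz, hz1⟩
    -- A zero root contributes |eᵗ|² = e^{2t} and no cosh factor.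
    · refine ⟨L + 2, s, hs, fun t ↦ ?_⟩
      have e : Real.exp ((L + 2) * t) = Real.exp (L * t) * Real.exp t ^ 2 := by
        rw [← Real.exp_nat_mul, ← Real.exp_add]
        congr 1
        push_cast
        ring
      simp only [Multiset.map_cons, Multiset.prod_cons, norm_mul, mul_pow, h t, sub_zero, norm_one,
        e, Complex.norm_real, Real.norm_eq_abs, sq_abs]
      ring
    · have hre : z.re < 1 := by
        refine lt_of_le_of_ne (hz ▸ Complex.re_le_norm z) fun hre ↦ hz1 ?_
        have h := Complex.normSq_apply z
        rw [Complex.normSq_eq_norm_sq, hz, hre] at h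
        exact Complex.ext hre (by simpa using h)
      have hre' : -1 ≤ z.re := by
        have := Complex.abs_re_le_norm z
        rw [hz, abs_le] at this
        exact this.1
      -- From |eᵗ - z|² = 2eᵗ (cosh t - Re z), normalized by its value at t = 0; a ≥ 1/2 because 0 <
      -- 1 - Re z ≤ 2.
      refine ⟨L + 1, (1 / (1 - z.re)) ::ₘ s, ?_, fun t ↦ ?_⟩
      · intro a ha
        rcases Multiset.mem_cons.1 ha with rfl | ha
        · exact one_div_le_one_div_of_le (by linarith) (by linarith)
        · exact hs a ha
      have h0 := sq_norm_exp_sub_of_norm_eq_one hz 0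
      have ht := sq_norm_exp_sub_of_norm_eq_one hz t
      rw [Real.exp_zero, Real.cosh_zero, Complex.ofReal_one] at h0
      have e : Real.exp ((L + 1) * t) = Real.exp (L * t) * Real.exp t := by
        rw [← Real.exp_add, add_one_mul]
      simp only [Multiset.map_cons, Multiset.prod_cons, norm_mul, mul_pow, h t, h0, ht, e]
      have key : Real.cosh t - z.re =
          (1 - z.re) * (1 + 1 / (1 - z.re) * (Real.cosh t - 1)) := by
        have : 1 - z.re ≠ 0 := by linarith
        field_simp
        ring
      rw [key]
      ring

/-- Squaring turns each root's factor into a real squared modulus, so conjugate roots need not be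
paired. The root 1 is excluded by f(1) > 0. -/
lemma IsCGF.exists_sq_realEval_exp_eq {f : ℕ[X]} (hf : IsCGF f) :
    ∃ (L : ℝ) (s : Multiset ℝ), (∀ a ∈ s, 1 / 2 ≤ a) ∧ ∀ t : ℝ,
      (realEval f (Real.exp t) / realEval f 1) ^ 2 =
        Real.exp (L * t) * (s.map fun a ↦ 1 + a * (Real.cosh t - 1)).prod := by
  set F := f.map (Nat.castRingHom ℂ) with hF
  have h1 := hf.realEval_one_pos
  have hF1 : F.eval 1 ≠ 0 := by
    have := ofReal_realEval f 1
    rw [Complex.ofReal_one] at this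
    rw [← this]
    exact_mod_cast h1.ne'
  obtain ⟨L, s, hs, h⟩ := exists_sq_norm_prod_exp_sub_eq F.roots fun z hz ↦ by
    have hz := isRoot_of_mem_roots hz
    refine (hf.2 z hz).imp_right fun ⟨n, hn, hzn⟩ ↦
      ⟨Complex.norm_eq_one_of_pow_eq_one hzn hn.ne', ?_⟩
    rintro rfl
    exact hF1 hz
  refine ⟨L, s, hs, fun t ↦ ?_⟩
  have key (x : ℝ) : realEval f x ^ 2 =
      ‖F.leadingCoeff‖ ^ 2 * ‖(F.roots.map fun z ↦ (x : ℂ) - z).prod‖ ^ 2 := by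
    rw [← mul_pow, ← norm_mul, ← (IsAlgClosed.splits F).eval_eq_prod_roots, hF,
      ← ofReal_realEval, Complex.norm_real, Real.norm_eq_abs, sq_abs]
  have k1 := key 1
  rw [Complex.ofReal_one] at k1
  rw [div_pow, div_eq_iff (pow_pos h1 2).ne', key, h, k1]
  ring

/-! ### Products of the functions `1 + a (cosh t - 1)` -/

/-- `∏ (1 + a (Y - 1))`, with `Y` standing for `cosh t`. -/
noncomputable def coshPoly (s : Multiset ℝ) : ℝ[X] := (s.map fun a ↦ 1 + C a * (X - 1)).prod

lemma eval_coshPoly (s : Multiset ℝ) (y : ℝ) :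
    (coshPoly s).eval y = (s.map fun a ↦ 1 + a * (y - 1)).prod := by
  simp [coshPoly, eval_multiset_prod]

lemma eval_one_coshPoly (s : Multiset ℝ) : (coshPoly s).eval 1 = 1 := by
  simp [eval_coshPoly]

lemma eval_one_derivative_coshPoly (s : Multiset ℝ) : (coshPoly s).derivative.eval 1 = s.sum := by
  induction s using Multiset.induction_on with
  | empty => simp [coshPoly]
  | cons a s ih =>
    have : coshPoly (a ::ₘ s) = (1 + C a * (X - 1)) * coshPoly s := by simp [coshPoly]
    simp [this, ih, eval_one_coshPoly]

/-- Each factor obeys 1 + x ≤ eˣ; the loss is harmless because only the sum of the parameters, twice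
the variance, survives. -/
lemma eval_coshPoly_le_exp (s : Multiset ℝ) (hs : ∀ a ∈ s, 0 ≤ a) {y : ℝ} (hy : 1 ≤ y) :
    (coshPoly s).eval y ≤ Real.exp (s.sum * (y - 1)) := by
  rw [eval_coshPoly]
  induction s using Multiset.induction_on with
  | empty => simp
  | cons a s ih =>
    have hs' : ∀ b ∈ s, 0 ≤ b := fun b hb ↦ hs b (Multiset.mem_cons_of_mem hb)
    have ha := hs a (Multiset.mem_cons_self a s)
    rw [Multiset.map_cons, Multiset.prod_cons, Multiset.sum_cons, add_mul a,
      Real.exp_add]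
    refine mul_le_mul (by linarith [Real.add_one_le_exp (a * (y - 1))]) (ih hs') ?_
      (Real.exp_pos _).le
    refine Multiset.prod_nonneg fun x hx ↦ ?_
    obtain ⟨b, hb, rfl⟩ := Multiset.mem_map.1 hx
    have := mul_nonneg (hs' b hb) (sub_nonneg.2 hy)
    linarith

/-! ### The standardized random variables -/

section

variable {Ω : Type*} [MeasurableSpace Ω] {P : Measure Ω} {f : ℕ[X]} {X : Ω → ℝ}

lemma HasPGF.aemeasurable_standardize (hX : HasPGF f X P) : AEMeasurable (standardize X P) P :=
  (hX.aemeasurable.sub_const _).div_const _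

variable [IsProbabilityMeasure P]

/-- The law of a random variable corresponding to `f` is carried by the exponents of `f`. -/
lemma HasPGF.ae_map_mem (hX : HasPGF f X P) (hf : IsCGF f) :
    ∀ᵐ x ∂(P.map X), x ∈ (((Finset.range (f.natDegree + 1)).map Nat.castEmbedding : Finset ℝ) :
      Set ℝ) := by
  have := Measure.isProbabilityMeasure_map hX.aemeasurable
  have h1 := hf.realEval_one_pos
  -- The prescribed point masses already add up to f(1)/f(1) = 1.
  have h : (P.map X).real ((Finset.range (f.natDegree + 1)).map Nat.castEmbedding : Finset ℝ) =
      1 := by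
    rw [← sum_measureReal_singleton, Finset.sum_map]
    simp only [Nat.castEmbedding_apply]
    simp_rw [map_measureReal_apply_of_aemeasurable hX.aemeasurable (measurableSet_singleton _),
      hX.prob, ← realEval_one]
    rw [← Finset.sum_div, div_eq_one_iff_eq h1.ne', realEval_eq_sum]
    simp
  rw [ae_iff]
  exact (prob_compl_eq_zero_iff (Finset.measurableSet _)).2 (by
    rwa [measureReal_def, ENNReal.toReal_eq_one_iff] at h)

lemma HasPGF.integrable_exp (hX : HasPGF f X P) (hf : IsCGF f) (t : ℝ) :
    Integrable (fun ω ↦ Real.exp (t * X ω)) P := by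
  have hae := ae_of_ae_map hX.aemeasurable (hX.ae_map_mem hf)
  refine Integrable.of_bound (hX.aemeasurable.const_mul t).exp.aestronglyMeasurable
    (∑ k ∈ Finset.range (f.natDegree + 1), Real.exp (t * k)) (hae.mono fun ω hω ↦ ?_)
  obtain ⟨k, hk, hkω⟩ := Finset.mem_map.1 (Finset.mem_coe.1 hω)
  rw [← hkω, Real.norm_eq_abs, Real.abs_exp]
  exact Finset.single_le_sum (f := fun k : ℕ ↦ Real.exp (t * k))
    (fun _ _ ↦ (Real.exp_pos _).le) hk

lemma HasPGF.mgf_eq (hX : HasPGF f X P) (hf : IsCGF f) (t : ℝ) :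
    mgf X P t = realEval f (Real.exp t) / realEval f 1 := by
  have := Measure.isProbabilityMeasure_map hX.aemeasurable
  have hint : Integrable (fun x ↦ Real.exp (t * x)) (P.map X) :=
    (integrable_map_measure (by fun_prop) hX.aemeasurable).2 (hX.integrable_exp hf t)
  rw [mgf, ← integral_map (f := fun x ↦ Real.exp (t * x)) hX.aemeasurable (by fun_prop),
    ← Measure.restrict_eq_self_of_ae_mem (hX.ae_map_mem hf), setIntegral_finset _ hint.integrableOn,
    Finset.sum_map]
  simp only [Nat.castEmbedding_apply]
  simp_rw [map_measureReal_apply_of_aemeasurable hX.aemeasurable (measurableSet_singleton _),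
    hX.prob, ← realEval_one]
  rw [realEval_eq_sum f (Real.exp t), Finset.sum_div]
  refine Finset.sum_congr rfl fun k _ ↦ ?_
  rw [smul_eq_mul, ← Real.exp_nat_mul, mul_comm t]
  ring

/-- The moment generating function of a centered random variable corresponding to a cyclotomic
generating function is controlled by its variance, which is either zero or at least `1/4`. -/
lemma HasPGF.mgf_le (hX : HasPGF f X P) (hf : IsCGF f) :
    (variance X P = 0 ∨ 1 / 4 ≤ variance X P) ∧
    ∀ t, mgf X P t ≤ Real.exp (t * ∫ ω, X ω ∂P + variance X P * (Real.cosh t - 1)) := by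
  obtain ⟨L, s, hs, hsq⟩ := hf.exists_sq_realEval_exp_eq
  have hexp := hX.integrable_exp hf
  have hmem (t : ℝ) : t ∈ interior (integrableExpSet X P) := by
    rw [interior_integrableExpSet_eq_univ hexp]; trivial
  simp_rw [← hX.mgf_eq hf, ← eval_coshPoly] at hsq
  set q := coshPoly s
  set M₁ : ℝ → ℝ := fun t ↦ ∫ ω, X ω * Real.exp (t * X ω) ∂P
  set M₂ : ℝ := ∫ ω, X ω ^ 2 ∂P
  have hM (t : ℝ) : HasDerivAt (mgf X P) (M₁ t) t := hasDerivAt_mgf (hmem t)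
  have hM₁ : HasDerivAt M₁ M₂ 0 := by
    have := hasDerivAt_integral_pow_mul_exp_real (hmem 0) 1
    simpa [M₁, M₂] using this
  have hM0 : mgf X P 0 = 1 := mgf_zero
  have hE (t : ℝ) : HasDerivAt (fun t ↦ Real.exp (L * t)) (L * Real.exp (L * t)) t := by
    simpa [mul_comm] using ((hasDerivAt_id t).const_mul L).exp
  have hq (p : ℝ[X]) (t : ℝ) : HasDerivAt (fun t ↦ p.eval (Real.cosh t))
      (p.derivative.eval (Real.cosh t) * Real.sinh t) t :=
    (p.hasDerivAt _).comp t (Real.hasDerivAt_cosh t)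
  -- Derivative of the identity for the squared mgf; at t = 0 it reads 2μ = L.
  have hfirst (t : ℝ) : 2 * (mgf X P t * M₁ t) = L * Real.exp (L * t) * q.eval (Real.cosh t) +
      Real.exp (L * t) * (q.derivative.eval (Real.cosh t) * Real.sinh t) := by
    have h1 := (hM t).fun_pow 2
    simp_rw [hsq] at h1
    have h2 := h1.unique ((hE t).mul (hq q t))
    rw [← h2]
    simp
    ring
  -- Second derivative at 0, where sinh 0 = 0 leaves only L² and q'(1) = ∑ a.
  have hsecond : 2 * (M₁ 0 * M₁ 0 + M₂) = L ^ 2 + s.sum := by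
    have h1 := ((hM 0).fun_mul hM₁).const_mul 2
    simp_rw [hfirst] at h1
    have h2 := h1.unique ((((hE 0).const_mul L).fun_mul (hq q 0)).fun_add
      ((hE 0).fun_mul ((hq q.derivative 0).fun_mul (Real.hasDerivAt_sinh 0))))
    simp only [hM0, mul_zero, Real.exp_zero, Real.cosh_zero, Real.sinh_zero, q, eval_one_coshPoly,
      eval_one_derivative_coshPoly] at h2
    linarith
  have hmean : M₁ 0 = ∫ ω, X ω ∂P := by simp [M₁]
  have hL : 2 * ∫ ω, X ω ∂P = L := by
    have := hfirst 0
    simpa [hM0, hmean, q, eval_one_coshPoly] using this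
  have hX2 : MemLp X 2 P := by
    rw [memLp_two_iff_integrable_sq hX.aemeasurable.aestronglyMeasurable]
    exact integrable_pow_of_forall_integrable_exp hexp 2
  have hvar : 2 * variance X P = s.sum := by
    rw [variance_eq_sub hX2]
    rw [hmean, ← hL] at hsecond
    simp only [Pi.pow_apply]
    change 2 * (M₂ - _) = _
    linarith
  refine ⟨?_, fun t ↦ ?_⟩
  -- Without factors the variance vanishes; otherwise 2σ² = ∑ a is at least a single a ≥ 1/2.
  · rcases s.empty_or_exists_mem with rfl | ⟨a, ha⟩
    · left
      simpa using hvar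
    · right
      have := Multiset.single_le_sum (fun b hb ↦ (by norm_num : (0 : ℝ) ≤ 1 / 2).trans (hs b hb)) a ha
      linarith [hs a ha]
  · refine le_of_sq_le_sq ?_ (Real.exp_pos _).le
    rw [hsq t, ← Real.exp_nat_mul, ← hL]
    refine (mul_le_mul_of_nonneg_left (eval_coshPoly_le_exp s
      (fun b hb ↦ (by norm_num : (0 : ℝ) ≤ 1 / 2).trans (hs b hb)) (Real.one_le_cosh t))
      (Real.exp_pos _).le).trans_eq ?_
    rw [← Real.exp_add, ← hvar]
    congr 1
    push_cast
    ring

/-- A bound on the moment generating functions of all standardized random variables corresponding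
to cyclotomic generating functions. -/
noncomputable def standardMGFBound (t : ℝ) : ℝ := Real.exp (t ^ 2 / 2 * Real.exp (2 * t ^ 2))

/-- With w = t²/(2v), cosh(t/√v) - 1 ≤ eʷ - 1 ≤ w eʷ. The prefactor v w = t²/2 does not involve v,
and v ≥ 1/4 gives w ≤ 2t². -/
lemma mul_cosh_div_sqrt_sub_one_le {v : ℝ} (hv : 1 / 4 ≤ v) (t : ℝ) :
    v * (Real.cosh (t / √v) - 1) ≤ t ^ 2 / 2 * Real.exp (2 * t ^ 2) := by
  have hv0 : 0 < v := by linarith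
  set w := (t / √v) ^ 2 / 2 with hw
  have hwv : v * w = t ^ 2 / 2 := by
    rw [hw, div_pow, Real.sq_sqrt hv0.le]
    field_simp
  have hw2 : w ≤ 2 * t ^ 2 := by
    have h : v * w ≤ v * (2 * t ^ 2) := by
      rw [hwv]
      nlinarith [mul_le_mul_of_nonneg_right hv (sq_nonneg t)]
    exact le_of_mul_le_mul_left h hv0
  have hexp : Real.exp w - 1 ≤ w * Real.exp w := by
    have h := Real.add_one_le_exp (-w)
    have h2 := mul_le_mul_of_nonneg_right h (Real.exp_pos w).le
    rw [← Real.exp_add, neg_add_cancel, Real.exp_zero] at h2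
    linarith
  calc v * (Real.cosh (t / √v) - 1) ≤ v * (w * Real.exp w) := by
        refine mul_le_mul_of_nonneg_left ?_ hv0.le
        linarith [Real.cosh_le_exp_half_sq (t / √v)]
    _ = t ^ 2 / 2 * Real.exp w := by rw [← mul_assoc, hwv]
    _ ≤ _ := by gcongr

lemma HasPGF.mgfBoundedBy_map_standardize (hX : HasPGF f X P) (hf : IsCGF f) :
    MGFBoundedBy standardMGFBound (P.map (standardize X P)) := by
  intro t
  obtain ⟨hv, hle⟩ := hX.mgf_le hf
  set v := variance X P with hvdef
  set μ := ∫ ω, X ω ∂P with hμ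
  have e : (fun ω ↦ Real.exp (t * standardize X P ω)) =
      fun ω ↦ Real.exp (-(t / √v * μ)) * Real.exp (t / √v * X ω) := by
    funext ω
    rw [← Real.exp_add, standardize, ← hμ, ← hvdef]
    congr 1
    ring
  have hm : AEMeasurable (standardize X P) P := hX.aemeasurable_standardize
  refine ⟨(integrable_map_measure (by fun_prop) hm).2 ?_, ?_⟩
  · change Integrable (fun ω ↦ Real.exp (t * standardize X P ω)) P
    rw [e]
    exact (hX.integrable_exp hf _).const_mul _
  rw [integral_map hm (by fun_prop), e, integral_const_mul]
  refine (mul_le_mul_of_nonneg_left (hle (t / √v)) (Real.exp_pos _).le).trans ?_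
  rw [← Real.exp_add, standardMGFBound, Real.exp_le_exp, neg_add_cancel_left]
  -- For zero variance the exponent is 0, matching the convention that the standardized variable is
  -- 0.
  rcases hv with hv | hv
  · rw [hv, zero_mul]
    positivity
  · exact mul_cosh_div_sqrt_sub_one_le hv t

end

lemma moment_eq_integral_map {Ω : Type*} [MeasurableSpace Ω] {P : Measure Ω} {Y : Ω → ℝ}
    (hY : AEMeasurable Y P) (d : ℕ) : moment Y d P = ∫ x, x ^ d ∂(P.map Y) := by
  rw [integral_map hY (by fun_prop)]
  rfl

theorem theorem1p5 {Ω : ℕ → Type*} [∀ N, MeasurableSpace (Ω N)]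
    (P : (N : ℕ) → Measure (Ω N)) [∀ N, IsProbabilityMeasure (P N)]
    (f : ℕ → ℕ[X]) (hf : ∀ N, IsCGF (f N))
    (X : (N : ℕ) → Ω N → ℝ) (hX : ∀ N, HasPGF (f N) (X N) (P N)) :
    (ConvergesInDistribution (fun N => standardize (X N) (P N)) P ↔
      ∀ d : ℕ, 1 ≤ d → ∃ m : ℝ,
        Tendsto (fun N => moment (standardize (X N) (P N)) d (P N)) atTop (𝓝 m)) ∧
    ∀ {Ω' : Type*} [MeasurableSpace Ω'] (P' : Measure Ω') [IsProbabilityMeasure P']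
      (Y : Ω' → ℝ),
      TendstoInDistribution (fun N => standardize (X N) (P N)) atTop Y P P' →
      (∀ d : ℕ, 1 ≤ d → Integrable (fun ω => Y ω ^ d) P' ∧
        Tendsto (fun N => moment (standardize (X N) (P N)) d (P N)) atTop (𝓝 (moment Y d P'))) ∧
      DeterminedByMoments Y P' ∧ HasEntireMGF Y P' := by
  have hm (N : ℕ) : AEMeasurable (standardize (X N) (P N)) (P N) := (hX N).aemeasurable_standardize
  set ν : ℕ → ProbabilityMeasure ℝ := fun N ↦
    ⟨(P N).map (standardize (X N) (P N)), Measure.isProbabilityMeasure_map (hm N)⟩ with hν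
  have hC (N : ℕ) : MGFBoundedBy standardMGFBound (ν N : Measure ℝ) :=
    (hX N).mgfBoundedBy_map_standardize (hf N)
  have hmom (N d : ℕ) : moment (standardize (X N) (P N)) d (P N) = ∫ x, x ^ d ∂(ν N : Measure ℝ) :=
    moment_eq_integral_map (hm N) d
  simp_rw [hmom]
  refine ⟨⟨?_, fun h ↦ ?_⟩, ?_⟩
  · rintro ⟨ρ, hρ⟩ d -
    exact ⟨_, MGFBoundedBy.tendsto_moment hC hρ.tendsto d⟩
  · have h' (d : ℕ) : ∃ m : ℝ, Tendsto (fun N ↦ ∫ x, x ^ d ∂(ν N : Measure ℝ)) atTop (𝓝 m) := by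
      -- The hypothesis starts at d = 1; the zeroth moment is always 1.
      rcases Nat.eq_zero_or_pos d with rfl | hd
      · exact ⟨1, by simp⟩
      · exact h d hd
    choose m hm' using h'
    obtain ⟨ρ, hρ⟩ := MGFBoundedBy.exists_tendsto_of_tendsto_moment hC hm'
    refine ⟨ρ, ⟨hm, aemeasurable_id, ?_⟩⟩
    convert! hρ using 2
    exact congrArg 𝓝 (Subtype.ext Measure.map_id)
  · intro Ω' _ P' _ Y hY
    have hYm := hY.aemeasurable_limit
    have hbd : MGFBoundedBy standardMGFBound (P'.map Y) := MGFBoundedBy.of_tendsto hC hY.tendsto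
    have hprob : IsProbabilityMeasure (P'.map Y) := Measure.isProbabilityMeasure_map hYm
    have hexp (t : ℝ) : Integrable (fun ω ↦ Real.exp (t * Y ω)) P' :=
      (integrable_map_measure (f := Y) (g := fun x ↦ Real.exp (t * x)) (by fun_prop) hYm).1
        (hbd t).1
    have hint := integrable_pow_of_forall_integrable_exp hexp
    refine ⟨fun d _ ↦ ⟨hint d, ?_⟩, ⟨hint, fun ρ hρ hρint hρmom ↦ ?_⟩, hexp,
      differentiable_complexMGF hexp⟩
    · rw [moment_eq_integral_map hYm]
      exact MGFBoundedBy.tendsto_moment hC hY.tendsto d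
    · exact eq_of_moments_eq (fun t ↦ (hbd t).1) hρint fun d ↦ by
        rw [hρmom, moment_eq_integral_map hYm]
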